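/- Let $p,q$ be nonzero natural numbers. A metallic Riemannian manifold (with parameters $p,q$) is a triple $(M,g,J)$ in which $(M,g)$ is a smooth Riemannian manifold and $J$ is a smooth $(1,1)$-tensor field on $M$ with $J^2=pJ+qI$ and $g(JX,Y)=g(X,JY)$ for all vector fields $X,Y$. It is called locally metallic if moreover $\nabla J=0$, where $\nabla$ is the Levi-Civita connection of $g$. Let $(M_1,g_1,J_1)$ and $(M_2,g_2,J_2)$ be two locally metallic Riemannian manifolds with the same parameters $p,q$, and let $f$ be a smooth positive function on $M_1$. On $M_1\times M_2$, with projections $p_1,p_2$ onto the factors, consider the warped product metric $\widetilde g=p_1^*g_1+(f\circ p_1)^2\,p_2^*g_2$ and the tensor field $\widetilde J(X,Y)=(J_1X,J_2Y)$ for $(X,Y)\in T_xM_1\times T_yM_2=T_{(x,y)}(M_1\times M_2)$. Then $(M_1\times M_2,\widetilde g,\widetilde J)$ is a locally metallic Riemannian manifold (with parameters $p,q$) if and only if $$(d(f^2)\circ J_1)\otimes I=d(f^2)\otimes J_2\qquad\text{and}\qquad g_2(J_2\,\cdot,\cdot)\,\mathrm{grad}(f^2)=g_2(\cdot,\cdot)\,J_1(\mathrm{grad}(f^2)),$$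 that is, if and only if for all $x\in M_1$, $y\in M_2$, $X\in T_xM_1$ and $V,W\in T_yM_2$ $$d(f^2)_x(J_1X)\,V=d(f^2)_x(X)\,J_2V\qquad\text{and}\qquad g_2(J_2V,W)\,\mathrm{grad}(f^2)_x=g_2(V,W)\,J_1(\mathrm{grad}(f^2)_x),$$ where $\mathrm{grad}$ is the gradient with respect to $g_1$. -/

import Mathlib

open Bundle Manifold
open scoped ContDiff Topology

noncomputable section

section Basic

variable {E : Type*} [NormedAddCommGroup E] [NormedSpace ℝ E]
  {H : Type*} [TopologicalSpace H] (I : ModelWithCorners ℝ E H)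
  (M : Type*) [TopologicalSpace M] [ChartedSpace H M] [IsManifold I ∞ M]

/-- A smooth Riemannian metric on the manifold `M`. -/
abbrev RiemMetric : Type _ :=
  ContMDiffRiemannianMetric I ∞ E (fun x : M ↦ TangentSpace I x)

variable {I M}

/-- `cov` is a Levi-Civita connection of `g`: a covariant derivative on the tangent bundle that is
torsion-free and compatible with `g`. (Every metric has one, and any two agree on all
differentiable vector fields.) -/
def IsLeviCivita [FiniteDimensional ℝ E] (g : RiemMetric I M)
    (cov : CovariantDerivative I E (fun x : M ↦ TangentSpace I x)) : Prop :=
  cov.torsion = 0 ∧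
    (letI : RiemannianBundle (fun x : M ↦ TangentSpace I x) := ⟨g.toRiemannianMetric⟩
    CovariantDerivative.IsMetricCompatible (V := fun x : M ↦ TangentSpace I x) (F := E) cov)

/-- The endomorphism field `J` is parallel for the covariant derivative `cov`:
`∇_X (J Y) = J (∇_X Y)` at every point, for all tangent vectors `X` and all vector fields `Y`
differentiable at the point. Recall that `cov Y x X` is `∇_X Y` at `x`. -/
def IsParallelEnd (cov : CovariantDerivative I E (fun x : M ↦ TangentSpace I x))
    (J : ∀ x : M, TangentSpace I x →L[ℝ] TangentSpace I x) : Prop :=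
  ∀ (Y : ∀ x : M, TangentSpace I x) (x : M), MDiffAt (T% Y) x →
    ∀ X : TangentSpace I x, cov (fun y ↦ J y (Y y)) x X = J x (cov Y x X)

/-- `(M, g, J)` is a metallic Riemannian manifold with parameters `p`, `q`: `J` is a smooth field
of endomorphisms of the tangent spaces with `J² = p J + q Id`, and `g` is `J`-compatible. -/
structure IsMetallicRiemannian (p q : ℕ) (g : RiemMetric I M)
    (J : ∀ x : M, TangentSpace I x →L[ℝ] TangentSpace I x) : Prop where
  smooth : ContMDiff I (I.prod 𝓘(ℝ, E →L[ℝ] E)) ∞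
    (fun x ↦ TotalSpace.mk' (E →L[ℝ] E)
      (E := fun x : M ↦ TangentSpace I x →L[ℝ] TangentSpace I x) x (J x))
  metallic : ∀ (x : M) (X : TangentSpace I x), J x (J x X) = (p : ℝ) • J x X + (q : ℝ) • X
  compatible : ∀ (x : M) (X Y : TangentSpace I x), g.inner x (J x X) Y = g.inner x X (J x Y)

/-- `(M, g, J)` is locally metallic: it is a metallic Riemannian manifold and `J` is parallel for
the Levi-Civita connection of `g`. -/
def IsLocallyMetallic [FiniteDimensional ℝ E] (p q : ℕ) (g : RiemMetric I M)
    (J : ∀ x : M, TangentSpace I x →L[ℝ] TangentSpace I x) : Prop :=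
  IsMetallicRiemannian p q g J ∧
    ∃ cov : CovariantDerivative I E (fun x : M ↦ TangentSpace I x),
      IsLeviCivita g cov ∧ IsParallelEnd cov J

lemma exists_metric_dual [FiniteDimensional ℝ E] (g : RiemMetric I M) (x : M)
    (α : TangentSpace I x →L[ℝ] ℝ) :
    ∃ v : TangentSpace I x, ∀ w : TangentSpace I x, g.inner x v w = α w := by
  have : FiniteDimensional ℝ (TangentSpace I x) := inferInstanceAs (FiniteDimensional ℝ E)
  let L : TangentSpace I x →ₗ[ℝ] Module.Dual ℝ (TangentSpace I x) :=
    { toFun := fun v ↦ (g.inner x v : TangentSpace I x →ₗ[ℝ] ℝ)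
      map_add' := fun a b ↦ by ext; simp
      map_smul' := fun a b ↦ by ext; simp }
  have hinj : Function.Injective L := by
    rw [injective_iff_map_eq_zero]
    intro v hv
    by_contra h
    have h1 := g.pos x v h
    have h2 : g.inner x v v = 0 := LinearMap.congr_fun hv v
    exact h1.ne' h2
  have hsurj : Function.Surjective L :=
    (LinearMap.injective_iff_surjective_of_finrank_eq_finrank
      (Subspace.dual_finrank_eq).symm).1 hinj
  obtain ⟨v, hv⟩ := hsurj (α : TangentSpace I x →ₗ[ℝ] ℝ)
  exact ⟨v, fun w ↦ LinearMap.congr_fun hv w⟩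

/-- The gradient of the function `φ` with respect to `g` at `x`: the tangent vector `v` with
`g(v, w) = dφ(w)` for all `w`. -/
def metricGrad [FiniteDimensional ℝ E] (g : RiemMetric I M) (φ : M → ℝ) (x : M) :
    TangentSpace I x :=
  (exists_metric_dual g x (mvfderiv I φ x)).choose

lemma inner_metricGrad [FiniteDimensional ℝ E] (g : RiemMetric I M) (φ : M → ℝ) (x : M)
    (w : TangentSpace I x) : g.inner x (metricGrad g φ x) w = mvfderiv I φ x w :=
  (exists_metric_dual g x (mvfderiv I φ x)).choose_spec w

end Basic

section Pullback

variable {E : Type*} [NormedAddCommGroup E] [NormedSpace ℝ E]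
  {H : Type*} [TopologicalSpace H] {I : ModelWithCorners ℝ E H}
  {M : Type*} [TopologicalSpace M] [ChartedSpace H M]
  {E' : Type*} [NormedAddCommGroup E'] [NormedSpace ℝ E']
  {H' : Type*} [TopologicalSpace H'] {I' : ModelWithCorners ℝ E' H'}
  {N : Type*} [TopologicalSpace N] [ChartedSpace H' N] [IsManifold I' ∞ N]

lemma bilin_nonneg {x : M} (B : TangentSpace I x →L[ℝ] TangentSpace I x →L[ℝ] ℝ)
    (h : ∀ w, w ≠ 0 → 0 < B w w) (w : TangentSpace I x) : 0 ≤ B w w := by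
  rcases eq_or_ne w 0 with rfl | hw
  · simp
  · exact (h w hw).le

/-- The pullback `Φ^* g` of a Riemannian metric, a field of bilinear forms. -/
def pullbackMetric (Φ : M → N) (g : RiemMetric I' N) (x : M) :
    TangentSpace I x →L[ℝ] TangentSpace I x →L[ℝ] ℝ :=
  (ContinuousLinearMap.precomp ℝ (mfderiv I I' Φ x)) ∘L (g.inner (Φ x) ∘L mfderiv I I' Φ x)

lemma pullbackMetric_apply (Φ : M → N) (g : RiemMetric I' N) (x : M) (u v : TangentSpace I x) :
    pullbackMetric Φ g x u v =
      g.inner (Φ x) (mfderiv I I' Φ x u) (mfderiv I I' Φ x v) := rfl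

lemma contMDiff_pullbackMetric [IsManifold I ∞ M] {Φ : M → N} (hΦ : ContMDiff I I' ∞ Φ)
    (g : RiemMetric I' N) :
    ContMDiff I (I.prod 𝓘(ℝ, E →L[ℝ] E →L[ℝ] ℝ)) ∞
      (fun x ↦ TotalSpace.mk' (E →L[ℝ] E →L[ℝ] ℝ)
        (E := fun x : M ↦ TangentSpace I x →L[ℝ] TangentSpace I x →L[ℝ] ℝ) x
        (pullbackMetric Φ g x)) := by
  intro x₀
  rw [contMDiffAt_hom_bundle]
  refine ⟨contMDiffAt_id, ?_⟩
  have hg := g.contMDiff (Φ x₀)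
  rw [contMDiffAt_hom_bundle] at hg
  have hG := (hg.2.comp x₀ hΦ.contMDiffAt)
  have hD := (hΦ.contMDiffAt (x := x₀)).mfderiv_const (m := ∞) (by simp)
  have h1 := hG.clm_comp hD
  have h2 := hD.clm_precomp (F₃ := ℝ)
  refine (h2.clm_comp h1).congr_of_eventuallyEq ?_
  have A : ∀ᶠ x in 𝓝 x₀, x ∈ (trivializationAt E (TangentSpace I) x₀).baseSet :=
    (trivializationAt E (TangentSpace I) x₀).open_baseSet.mem_nhds
      (FiberBundle.mem_baseSet_trivializationAt' x₀)
  have A' : ∀ᶠ x in 𝓝 x₀, Φ x ∈ (trivializationAt E' (TangentSpace I') (Φ x₀)).baseSet :=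
    hΦ.continuous.continuousAt ((trivializationAt E' (TangentSpace I') (Φ x₀)).open_baseSet.mem_nhds
      (FiberBundle.mem_baseSet_trivializationAt' (Φ x₀)))
  filter_upwards [A, A'] with x hx hx'
  ext u v
  have key : ∀ w : TangentSpace I' (Φ x),
      (trivializationAt E' (TangentSpace I') (Φ x₀)).symm (Φ x)
        ((trivializationAt E' (TangentSpace I') (Φ x₀)).continuousLinearMapAt ℝ (Φ x) w) = w :=
    fun w ↦ by
      have := (trivializationAt E' (TangentSpace I') (Φ x₀)).symmL_continuousLinearMapAt
        (R := ℝ) hx' w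
      rwa [Trivialization.symmL_apply _ hx'] at this
  change ContinuousLinearMap.inCoordinates E (TangentSpace I) (E →L[ℝ] ℝ)
      (fun b ↦ TangentSpace I b →L[ℝ] ℝ) x₀ x x₀ x (pullbackMetric Φ g x) u v =
    ContinuousLinearMap.inCoordinates E' (TangentSpace I') (E' →L[ℝ] ℝ)
      (fun b ↦ TangentSpace I' b →L[ℝ] ℝ) (Φ x₀) (Φ x) (Φ x₀) (Φ x) (g.inner (Φ x))
      (ContinuousLinearMap.inCoordinates E (TangentSpace I) E' (TangentSpace I')
        x₀ x (Φ x₀) (Φ x) (mfderiv I I' Φ x) u)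
      (ContinuousLinearMap.inCoordinates E (TangentSpace I) E' (TangentSpace I')
        x₀ x (Φ x₀) (Φ x) (mfderiv I I' Φ x) v)
  rw [inCoordinates_apply_eq₂ hx hx (Set.mem_univ _),
    inCoordinates_apply_eq₂ hx' hx' (Set.mem_univ _)]
  simp only [ContinuousLinearMap.inCoordinates, ContinuousLinearMap.comp_apply, key,
    pullbackMetric_apply, Trivialization.symmL_apply _ hx]
  rfl

end Pullback

section Warped

variable {E₁ : Type*} [NormedAddCommGroup E₁] [NormedSpace ℝ E₁]
  {H₁ : Type*} [TopologicalSpace H₁] {I₁ : ModelWithCorners ℝ E₁ H₁}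
  {M₁ : Type*} [TopologicalSpace M₁] [ChartedSpace H₁ M₁] [IsManifold I₁ ∞ M₁]
  {E₂ : Type*} [NormedAddCommGroup E₂] [NormedSpace ℝ E₂]
  {H₂ : Type*} [TopologicalSpace H₂] {I₂ : ModelWithCorners ℝ E₂ H₂}
  {M₂ : Type*} [TopologicalSpace M₂] [ChartedSpace H₂ M₂] [IsManifold I₂ ∞ M₂]

/-- The field of bilinear forms `p₁^* g₁ + (f ∘ p₁)² p₂^* g₂` on `M₁ × M₂`. -/
def warpedForm (g₁ : RiemMetric I₁ M₁) (g₂ : RiemMetric I₂ M₂) (f : M₁ → ℝ) (z : M₁ × M₂) :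
    TangentSpace (I₁.prod I₂) z →L[ℝ] TangentSpace (I₁.prod I₂) z →L[ℝ] ℝ :=
  pullbackMetric (I := I₁.prod I₂) Prod.fst g₁ z +
    (f z.1) ^ 2 • pullbackMetric (I := I₁.prod I₂) Prod.snd g₂ z

lemma warpedForm_apply (g₁ : RiemMetric I₁ M₁) (g₂ : RiemMetric I₂ M₂) (f : M₁ → ℝ)
    (z : M₁ × M₂) (u v : TangentSpace (I₁.prod I₂) z) :
    warpedForm g₁ g₂ f z u v =
      g₁.inner z.1 (mfderiv (I₁.prod I₂) I₁ Prod.fst z u) (mfderiv (I₁.prod I₂) I₁ Prod.fst z v) +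
        (f z.1) ^ 2 * g₂.inner z.2 (mfderiv (I₁.prod I₂) I₂ Prod.snd z u)
          (mfderiv (I₁.prod I₂) I₂ Prod.snd z v) := rfl

lemma warpedForm_pos (g₁ : RiemMetric I₁ M₁) (g₂ : RiemMetric I₂ M₂) {f : M₁ → ℝ}
    (hpos : ∀ x, 0 < f x) (z : M₁ × M₂) (v : TangentSpace (I₁.prod I₂) z) (hv : v ≠ 0) :
    0 < warpedForm g₁ g₂ f z v v := by
  rw [warpedForm_apply]
  have hf : 0 < f z.1 ^ 2 := pow_pos (hpos _) 2
  by_cases h1 : mfderiv (I₁.prod I₂) I₁ Prod.fst z v = 0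
  · have h2 : mfderiv (I₁.prod I₂) I₂ Prod.snd z v ≠ 0 := fun h2 ↦ by
      rw [mfderiv_fst] at h1
      rw [mfderiv_snd] at h2
      exact hv (Prod.ext h1 h2)
    exact add_pos_of_nonneg_of_pos (bilin_nonneg _ (g₁.pos _) _) (mul_pos hf (g₂.pos _ _ h2))
  · exact add_pos_of_pos_of_nonneg (g₁.pos _ _ h1)
      (mul_nonneg hf.le (bilin_nonneg _ (g₂.pos _) _))

lemma warpedForm_isVonNBounded (g₁ : RiemMetric I₁ M₁) (g₂ : RiemMetric I₂ M₂) {f : M₁ → ℝ}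
    (hpos : ∀ x, 0 < f x) (z : M₁ × M₂) :
    Bornology.IsVonNBounded ℝ
      {v : TangentSpace (I₁.prod I₂) z | warpedForm g₁ g₂ f z v v < 1} := by
  have hf : 0 < f z.1 := hpos _
  have b1 : Bornology.IsBounded {w : E₁ | g₁.inner z.1 w w < 1} :=
    (NormedSpace.isVonNBounded_iff ℝ).1 (g₁.isVonNBounded z.1)
  have b2 : Bornology.IsBounded {w : E₂ | g₂.inner z.2 w w < 1} :=
    (NormedSpace.isVonNBounded_iff ℝ).1 (g₂.isVonNBounded z.2)
  have key : ∀ v : TangentSpace (I₁.prod I₂) z, warpedForm g₁ g₂ f z v v < 1 →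
      g₁.inner z.1 (mfderiv (I₁.prod I₂) I₁ Prod.fst z v)
        (mfderiv (I₁.prod I₂) I₁ Prod.fst z v) < 1 ∧
      g₂.inner z.2 (f z.1 • mfderiv (I₁.prod I₂) I₂ Prod.snd z v)
        (f z.1 • mfderiv (I₁.prod I₂) I₂ Prod.snd z v) < 1 := by
    intro v hv
    rw [warpedForm_apply] at hv
    have h1 := bilin_nonneg _ (g₁.pos z.1) (mfderiv (I₁.prod I₂) I₁ Prod.fst z v)
    have h2 := mul_nonneg (sq_nonneg (f z.1))
      (bilin_nonneg _ (g₂.pos z.2) (mfderiv (I₁.prod I₂) I₂ Prod.snd z v))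
    refine ⟨by linarith, ?_⟩
    simp only [map_smul, smul_apply, smul_eq_mul]
    nlinarith
  refine ((NormedSpace.isVonNBounded_iff (E := E₁ × E₂) ℝ).2 (b1.prod (b2.smul₀ (f z.1)⁻¹))).subset
    ?_
  intro v hv
  obtain ⟨h1, h2⟩ := key v hv
  rw [mfderiv_fst] at h1
  rw [mfderiv_snd] at h2
  exact ⟨h1, _, h2, inv_smul_smul₀ hf.ne' _⟩

lemma contMDiff_warpedForm (g₁ : RiemMetric I₁ M₁) (g₂ : RiemMetric I₂ M₂) {f : M₁ → ℝ}
    (hf : ContMDiff I₁ 𝓘(ℝ, ℝ) ∞ f) :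
    ContMDiff (I₁.prod I₂) ((I₁.prod I₂).prod 𝓘(ℝ, E₁ × E₂ →L[ℝ] E₁ × E₂ →L[ℝ] ℝ)) ∞
      (fun z ↦ TotalSpace.mk' (E₁ × E₂ →L[ℝ] E₁ × E₂ →L[ℝ] ℝ)
        (E := fun z : M₁ × M₂ ↦ TangentSpace (I₁.prod I₂) z →L[ℝ]
          TangentSpace (I₁.prod I₂) z →L[ℝ] ℝ) z (warpedForm g₁ g₂ f z)) := by
  intro z₀
  have h1 := contMDiff_pullbackMetric (I := I₁.prod I₂) (M := M₁ × M₂) contMDiff_fst g₁ z₀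
  have h2 := contMDiff_pullbackMetric (I := I₁.prod I₂) (M := M₁ × M₂) contMDiff_snd g₂ z₀
  rw [contMDiffAt_hom_bundle] at h1 h2 ⊢
  have h3 : ContMDiffAt (I₁.prod I₂) 𝓘(ℝ, ℝ) ∞ (fun z : M₁ × M₂ ↦ (f z.1) ^ 2) z₀ :=
    (hf.comp contMDiff_fst).contMDiffAt.pow 2
  refine ⟨contMDiffAt_id, (h1.2.add (h3.smul h2.2)).congr_of_eventuallyEq ?_⟩
  filter_upwards [(trivializationAt (E₁ × E₂) (TangentSpace (I₁.prod I₂)) z₀).open_baseSet.mem_nhds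
      (FiberBundle.mem_baseSet_trivializationAt' z₀)] with z hz
  refine ContinuousLinearMap.ext fun u ↦ ContinuousLinearMap.ext fun v ↦ ?_
  simp only [Pi.add_apply, _root_.add_apply, _root_.smul_apply,
    Pi.smul_apply']
  rw [inCoordinates_apply_eq₂ hz hz (Set.mem_univ _), inCoordinates_apply_eq₂ hz hz (Set.mem_univ _),
    inCoordinates_apply_eq₂ hz hz (Set.mem_univ _), ← map_smul, ← map_add]
  rfl

/-- The metric of the warped product `M₁ ×_f M₂`: the Riemannian metric
`p₁^* g₁ + (f ∘ p₁)² p₂^* g₂` on `M₁ × M₂`, where `f` is smooth and positive. -/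
def warpedMetric (g₁ : RiemMetric I₁ M₁) (g₂ : RiemMetric I₂ M₂) (f : M₁ → ℝ)
    (hf : ContMDiff I₁ 𝓘(ℝ, ℝ) ∞ f) (hpos : ∀ x, 0 < f x) :
    RiemMetric (I₁.prod I₂) (M₁ × M₂) where
  inner := warpedForm g₁ g₂ f
  symm z u v := by
    rw [warpedForm_apply, warpedForm_apply, g₁.symm, g₂.symm]
  pos := warpedForm_pos g₁ g₂ hpos
  isVonNBounded := warpedForm_isVonNBounded g₁ g₂ hpos
  contMDiff := contMDiff_warpedForm g₁ g₂ hf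

/-- The product structure `J̃ = (J₁, J₂)` on `M₁ × M₂`, `J̃ (X, Y) = (J₁ X, J₂ Y)`, under the
identification of the tangent space of `M₁ × M₂` at `(x, y)` with `T_x M₁ × T_y M₂`. -/
def productEnd (J₁ : ∀ x : M₁, TangentSpace I₁ x →L[ℝ] TangentSpace I₁ x)
    (J₂ : ∀ y : M₂, TangentSpace I₂ y →L[ℝ] TangentSpace I₂ y) (z : M₁ × M₂) :
    TangentSpace (I₁.prod I₂) z →L[ℝ] TangentSpace (I₁.prod I₂) z :=
  (J₁ z.1).prodMap (J₂ z.2)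

end Warped

end

noncomputable section

section LeviCivita

variable {E : Type*} [NormedAddCommGroup E] [NormedSpace ℝ E] [FiniteDimensional ℝ E]
  {H : Type*} [TopologicalSpace H] {I : ModelWithCorners ℝ E H}
  {M : Type*} [TopologicalSpace M] [ChartedSpace H M] [IsManifold I ∞ M]

omit [FiniteDimensional ℝ E] in
lemma RiemMetric.mdifferentiableAt_inner (g : RiemMetric I M) {x : M}
    {Y Z : ∀ x : M, TangentSpace I x} (hY : MDiffAt (T% Y) x) (hZ : MDiffAt (T% Z) x) :
    MDifferentiableAt I 𝓘(ℝ, ℝ) (fun y ↦ g.inner y (Y y) (Z y)) x := by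
  let _ : RiemannianBundle (fun x : M ↦ TangentSpace I x) := ⟨g.toRiemannianMetric⟩
  exact MDifferentiableAt.inner_bundle (E := fun x : M ↦ TangentSpace I x) hY hZ

lemma isLeviCivita_iff (g : RiemMetric I M)
    (cov : CovariantDerivative I E (fun x : M ↦ TangentSpace I x)) :
    IsLeviCivita g cov ↔ cov.torsion = 0 ∧
      ∀ (x : M) (X : TangentSpace I x) (Y Z : ∀ x : M, TangentSpace I x),
        MDiffAt (T% Y) x → MDiffAt (T% Z) x →
        mvfderiv I (fun y ↦ g.inner y (Y y) (Z y)) x X =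
          g.inner x (cov Y x X) (Z x) + g.inner x (Y x) (cov Z x X) := by
  let _ : RiemannianBundle (fun x : M ↦ TangentSpace I x) := ⟨g.toRiemannianMetric⟩
  unfold IsLeviCivita
  refine and_congr_right fun _ ↦ ?_
  rw [CovariantDerivative.isMetricCompatible_iff]
  constructor
  · intro h x X Y Z hY hZ
    have := h (X := FiberBundle.extend E X) (FiberBundle.mdifferentiableAt_extend I E X) hY hZ
    simp only [FiberBundle.extend_apply_self] at this
    exact this
  · intro h x X Y Z _ hY hZ
    exact h x (X x) Y Z hY hZ

omit [FiniteDimensional ℝ E] in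
lemma RiemMetric.eq_zero_of_inner (g : RiemMetric I M) {x : M} {v : TangentSpace I x}
    (h : ∀ w, g.inner x v w = 0) : v = 0 := by
  by_contra hv
  exact (g.pos x v hv).ne' (h v)

lemma eq_zero_of_symm_of_antisymm {V W : Type*} (B : V → V → W → ℝ) (T : V → W)
    (hs : ∀ u v w, B u v w = B v u w) (ha : ∀ u v w, B u v (T w) = - B u w (T v)) (u v w : V) :
    B u v (T w) = 0 := by
  have h1 := ha u v w
  have h2 := ha w u v
  have h3 := ha v w u
  have h4 := hs u v (T w)
  have h5 := hs w u (T v)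
  have h6 := hs v w (T u)
  linarith

/-- The Levi-Civita connection is unique on differentiable vector fields. -/
lemma IsLeviCivita.unique {g : RiemMetric I M}
    {cov cov' : CovariantDerivative I E (fun x : M ↦ TangentSpace I x)}
    (h : IsLeviCivita g cov) (h' : IsLeviCivita g cov') {x : M}
    {Y : ∀ x : M, TangentSpace I x} (hY : MDiffAt (T% Y) x) : cov Y x = cov' Y x := by
  rw [isLeviCivita_iff] at h h'
  rw [CovariantDerivative.torsion_eq_zero_iff] at h h'
  let D (u v : TangentSpace I x) : TangentSpace I x :=
    cov (FiberBundle.extend E v) x u - cov' (FiberBundle.extend E v) x u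
  have hext : ∀ v : TangentSpace I x, MDiffAt (T% (FiberBundle.extend E v)) x :=
    fun v ↦ FiberBundle.mdifferentiableAt_extend I E v
  have hD : ∀ (Z : ∀ x : M, TangentSpace I x), MDiffAt (T% Z) x → ∀ u,
      cov Z x u - cov' Z x u = D u (Z x) := fun Z hZ u ↦ by
    have e := fun (Z : ∀ x : M, TangentSpace I x) (hZ : MDiffAt (T% Z) x) ↦
      IsCovariantDerivativeOn.difference_apply
        (cov.isCovariantDerivativeOn (s := Set.univ)) (cov'.isCovariantDerivativeOn (s := Set.univ))
        (x := x) (hx := trivial) hZ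
    have e1 := DFunLike.congr_fun (e Z hZ) u
    have e2 := DFunLike.congr_fun (e _ (hext (Z x))) u
    rw [FiberBundle.extend_apply_self] at e2
    exact e1.symm.trans e2
  have hs : ∀ u v, D u v = D v u := fun u v ↦ by
    have a := h.1 (hext u) (hext v)
    have b := h'.1 (hext u) (hext v)
    simp only [FiberBundle.extend_apply_self] at a b
    have c := a.trans b.symm
    rw [sub_eq_sub_iff_sub_eq_sub] at c
    exact c
  have ha : ∀ u v w, g.inner x (D u v) w = - g.inner x (D u w) v := fun u v w ↦ by
    have a := h.2 x u _ _ (hext v) (hext w)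
    have b := h'.2 x u _ _ (hext v) (hext w)
    simp only [FiberBundle.extend_apply_self] at a b
    rw [g.symm x v] at a b
    simp only [D, map_sub, sub_apply]
    linarith
  ext u
  rw [← sub_eq_zero, hD Y hY]
  refine g.eq_zero_of_inner fun w ↦ ?_
  exact eq_zero_of_symm_of_antisymm (fun u v w ↦ g.inner x (D u v) w) id
    (fun u v w ↦ by simp only [hs u v]) ha u (Y x) w

omit [FiniteDimensional ℝ E] in
lemma extend_eventually_eq {x : M} (v : TangentSpace I x) :
    ∀ᶠ y in 𝓝 x, FiberBundle.extend E v y =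
      (trivializationAt E (TangentSpace I) x).symmL ℝ y v := by
  filter_upwards [(trivializationAt E (TangentSpace I) x).open_baseSet.mem_nhds
    (FiberBundle.mem_baseSet_trivializationAt' x)] with y hy
  refine Eq.trans ?_ (Trivialization.symmL_apply (R := ℝ) _ hy (v : E)).symm
  unfold FiberBundle.extend
  congr 1
  rw [TangentBundle.trivializationAt_apply]
  exact tangentCoordChange_self (mem_extChartAt_source x)

omit [FiniteDimensional ℝ E] in
lemma mlieBracket_extend [CompleteSpace E] {x : M} (u v : TangentSpace I x) :
    VectorField.mlieBracket I (FiberBundle.extend E u) (FiberBundle.extend E v) x = 0 := by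
  have key : ∀ w : TangentSpace I x,
      VectorField.mpullbackWithin 𝓘(ℝ, E) I (extChartAt I x).symm (FiberBundle.extend E w)
        (Set.range I) =ᶠ[𝓝[Set.range I] (extChartAt I x x)] fun _ ↦ (w : E) := by
    intro w
    have hc : Filter.Tendsto (extChartAt I x).symm (𝓝[Set.range I] (extChartAt I x x)) (𝓝 x) := by
      have := (continuousAt_extChartAt_symm (I := I) x)
      rw [ContinuousAt, extChartAt_to_inv] at this
      exact this.mono_left nhdsWithin_le_nhds
    filter_upwards [hc.eventually (extend_eventually_eq w),
      extChartAt_target_mem_nhdsWithin (I := I) x] with y hy hy'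
    have hsrc : (extChartAt I x).symm y ∈ (chartAt H x).source := by
      rw [← extChartAt_source I]; exact (extChartAt I x).map_target hy'
    rw [VectorField.mpullbackWithin_apply, hy, TangentBundle.symmL_trivializationAt hsrc,
      (extChartAt I x).right_inv hy']
    have hinv := isInvertible_mfderivWithin_extChartAt_symm hy'
    exact hinv.inverse_apply_eq.2 rfl
  rw [← VectorField.mlieBracketWithin_univ, VectorField.mlieBracketWithin_apply]
  rw [Set.preimage_univ, Set.univ_inter]
  rw [Filter.EventuallyEq.lieBracketWithin_vectorField_eq (key u)
    ((key u).eq_of_nhdsWithin (Set.mem_range_self _)) (key v)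
    ((key v).eq_of_nhdsWithin (Set.mem_range_self _))]
  have hz : ∀ u v : E, VectorField.lieBracketWithin ℝ (fun _ : E ↦ u) (fun _ : E ↦ v)
      (Set.range I) (extChartAt I x x) = 0 := fun u v ↦ by
    rw [VectorField.lieBracketWithin_eq]
    simp
  exact (congrArg _ (hz u v)).trans (map_zero _)

lemma torsion_eq_zero_iff_extend
    (cov : CovariantDerivative I E (fun x : M ↦ TangentSpace I x)) :
    cov.torsion = 0 ↔ ∀ (x : M) (u v : TangentSpace I x),
      cov (FiberBundle.extend E v) x u = cov (FiberBundle.extend E u) x v := by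
  have : CompleteSpace E := FiniteDimensional.complete ℝ E
  have key : ∀ (x : M) (u v : TangentSpace I x), cov.torsion x u v =
      cov (FiberBundle.extend E v) x u - cov (FiberBundle.extend E u) x v := fun x u v ↦ by
    rw [cov.torsion_apply_eq_extend, mlieBracket_extend, sub_zero,
      FiberBundle.extend_apply_self, FiberBundle.extend_apply_self]
  constructor
  · intro h x u v
    rw [← sub_eq_zero, ← key, h]; rfl
  · intro h
    ext x u v
    rw [key, h, sub_self]; rfl

end LeviCivita

section ProductSection

variable {E₁ : Type*} [NormedAddCommGroup E₁] [NormedSpace ℝ E₁]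
  {H₁ : Type*} [TopologicalSpace H₁] {I₁ : ModelWithCorners ℝ E₁ H₁}
  {M₁ : Type*} [TopologicalSpace M₁] [ChartedSpace H₁ M₁]
  {E₂ : Type*} [NormedAddCommGroup E₂] [NormedSpace ℝ E₂]
  {H₂ : Type*} [TopologicalSpace H₂] {I₂ : ModelWithCorners ℝ E₂ H₂}
  {M₂ : Type*} [TopologicalSpace M₂] [ChartedSpace H₂ M₂]

/-- The first component of a vector field on `M₁ × M₂`, restricted to the slice `M₁ × {y}`. -/
def fstSection (Y : ∀ z : M₁ × M₂, TangentSpace (I₁.prod I₂) z) (y : M₂) (x : M₁) :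
    TangentSpace I₁ x := (Y (x, y)).1

/-- The second component of a vector field on `M₁ × M₂`, restricted to the slice `{x} × M₂`. -/
def sndSection (Y : ∀ z : M₁ × M₂, TangentSpace (I₁.prod I₂) z) (x : M₁) (y : M₂) :
    TangentSpace I₂ y := (Y (x, y)).2

/-- The derivative along the second factor of the first component of a vector field. -/
def fstCrossDeriv (Y : ∀ z : M₁ × M₂, TangentSpace (I₁.prod I₂) z) (z : M₁ × M₂) :
    TangentSpace I₂ z.2 →L[ℝ] TangentSpace I₁ z.1 :=
  mvfderiv I₂ (F := E₁) (fun y ↦ fstSection Y y z.1) z.2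

/-- The derivative along the first factor of the second component of a vector field. -/
def sndCrossDeriv (Y : ∀ z : M₁ × M₂, TangentSpace (I₁.prod I₂) z) (z : M₁ × M₂) :
    TangentSpace I₁ z.1 →L[ℝ] TangentSpace I₂ z.2 :=
  mvfderiv I₁ (F := E₂) (fun x ↦ sndSection Y x z.2) z.1

lemma mvfderiv_prod_apply {φ : M₁ × M₂ → ℝ} {z : M₁ × M₂}
    (hφ : MDifferentiableAt (I₁.prod I₂) 𝓘(ℝ, ℝ) φ z) (X : TangentSpace (I₁.prod I₂) z) :
    mvfderiv (I₁.prod I₂) φ z X =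
      mvfderiv I₁ (fun x ↦ φ (x, z.2)) z.1 X.1 + mvfderiv I₂ (fun y ↦ φ (z.1, y)) z.2 X.2 :=
  mfderiv_prod_eq_add_apply hφ

variable [IsManifold I₁ ∞ M₁] [IsManifold I₂ ∞ M₂]

lemma mdifferentiableAt_fst_component {Y : ∀ z : M₁ × M₂, TangentSpace (I₁.prod I₂) z}
    {z : M₁ × M₂} (hY : MDiffAt (T% Y) z) :
    MDifferentiableAt (I₁.prod I₂) (I₁.prod 𝓘(ℝ, E₁))
      (fun z ↦ (⟨z.1, (Y z).1⟩ : TangentBundle I₁ M₁)) z := by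
  have h : ContMDiff (I₁.prod I₂).tangent I₁.tangent 1
      (tangentMap (I₁.prod I₂) I₁ (Prod.fst : M₁ × M₂ → M₁)) :=
    (contMDiff_fst (n := ∞)).contMDiff_tangentMap (by norm_cast)
  have := (h.mdifferentiable one_ne_zero _).comp z hY
  convert! this using 2 with w
  simp only [tangentMap, mfderiv_fst, Function.comp]
  rfl

lemma mdifferentiableAt_snd_component {Y : ∀ z : M₁ × M₂, TangentSpace (I₁.prod I₂) z}
    {z : M₁ × M₂} (hY : MDiffAt (T% Y) z) :
    MDifferentiableAt (I₁.prod I₂) (I₂.prod 𝓘(ℝ, E₂))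
      (fun z ↦ (⟨z.2, (Y z).2⟩ : TangentBundle I₂ M₂)) z := by
  have h : ContMDiff (I₁.prod I₂).tangent I₂.tangent 1
      (tangentMap (I₁.prod I₂) I₂ (Prod.snd : M₁ × M₂ → M₂)) :=
    (contMDiff_snd (n := ∞)).contMDiff_tangentMap (by norm_cast)
  have := (h.mdifferentiable one_ne_zero _).comp z hY
  convert! this using 2 with w
  simp only [tangentMap, mfderiv_snd, Function.comp]
  rfl

lemma mdifferentiableAt_fstSection {Y : ∀ z : M₁ × M₂, TangentSpace (I₁.prod I₂) z}
    {z : M₁ × M₂} (hY : MDiffAt (T% Y) z) : MDiffAt (T% (fstSection Y z.2)) z.1 :=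
  (mdifferentiableAt_fst_component hY).comp (f := fun x ↦ (x, z.2)) z.1
    (mdifferentiableAt_id.prodMk mdifferentiableAt_const)

lemma mdifferentiableAt_sndSection {Y : ∀ z : M₁ × M₂, TangentSpace (I₁.prod I₂) z}
    {z : M₁ × M₂} (hY : MDiffAt (T% Y) z) : MDiffAt (T% (sndSection Y z.1)) z.2 :=
  (mdifferentiableAt_snd_component hY).comp (f := fun y ↦ (z.1, y)) z.2
    (mdifferentiableAt_const.prodMk mdifferentiableAt_id)

omit [IsManifold I₂ ∞ M₂] in
lemma mdifferentiableAt_of_fixed_base {x : M₁} {σ : M₂ → TangentSpace I₁ x} {y : M₂}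
    (h : MDifferentiableAt I₂ (I₁.prod 𝓘(ℝ, E₁))
      (fun y ↦ (⟨x, σ y⟩ : TangentBundle I₁ M₁)) y) :
    MDifferentiableAt (M' := E₁) I₂ 𝓘(ℝ, E₁) (fun y ↦ (σ y : E₁)) y := by
  rw [mdifferentiableAt_totalSpace] at h
  refine h.2.congr_of_eventuallyEq (Filter.Eventually.of_forall fun y' ↦ ?_)
  dsimp only
  rw [TangentBundle.trivializationAt_apply]
  exact (tangentCoordChange_self (mem_extChartAt_source x)).symm

lemma mdifferentiableAt_fstCross {Y : ∀ z : M₁ × M₂, TangentSpace (I₁.prod I₂) z}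
    {z : M₁ × M₂} (hY : MDiffAt (T% Y) z) :
    MDifferentiableAt (M' := E₁) I₂ 𝓘(ℝ, E₁) (fun y ↦ (fstSection Y y z.1 : E₁)) z.2 :=
  mdifferentiableAt_of_fixed_base <|
    (mdifferentiableAt_fst_component hY).comp (f := fun y ↦ (z.1, y)) z.2
      (mdifferentiableAt_const.prodMk mdifferentiableAt_id)

lemma mdifferentiableAt_sndCross {Y : ∀ z : M₁ × M₂, TangentSpace (I₁.prod I₂) z}
    {z : M₁ × M₂} (hY : MDiffAt (T% Y) z) :
    MDifferentiableAt (M' := E₂) I₁ 𝓘(ℝ, E₂) (fun x ↦ (sndSection Y x z.2 : E₂)) z.1 :=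
  mdifferentiableAt_of_fixed_base <|
    (mdifferentiableAt_snd_component hY).comp (f := fun x ↦ (x, z.2)) z.1
      (mdifferentiableAt_id.prodMk mdifferentiableAt_const)

lemma fstCrossDeriv_add {Y Y' : ∀ z : M₁ × M₂, TangentSpace (I₁.prod I₂) z} {z : M₁ × M₂}
    (hY : MDiffAt (T% Y) z) (hY' : MDiffAt (T% Y') z) :
    fstCrossDeriv (Y + Y') z = fstCrossDeriv Y z + fstCrossDeriv Y' z :=
  mvfderiv_add (mdifferentiableAt_fstCross hY) (mdifferentiableAt_fstCross hY')

lemma sndCrossDeriv_add {Y Y' : ∀ z : M₁ × M₂, TangentSpace (I₁.prod I₂) z} {z : M₁ × M₂}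
    (hY : MDiffAt (T% Y) z) (hY' : MDiffAt (T% Y') z) :
    sndCrossDeriv (Y + Y') z = sndCrossDeriv Y z + sndCrossDeriv Y' z :=
  mvfderiv_add (mdifferentiableAt_sndCross hY) (mdifferentiableAt_sndCross hY')

lemma fstCrossDeriv_smul {φ : M₁ × M₂ → ℝ} {Y : ∀ z : M₁ × M₂, TangentSpace (I₁.prod I₂) z}
    {z : M₁ × M₂} (hφ : MDifferentiableAt (I₁.prod I₂) 𝓘(ℝ, ℝ) φ z) (hY : MDiffAt (T% Y) z) :
    fstCrossDeriv (φ • Y) z = φ z • fstCrossDeriv Y z +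
      (mvfderiv I₂ (fun y ↦ φ (z.1, y)) z.2).smulRight (fstSection Y z.2 z.1) :=
  mvfderiv_smul (hφ.comp (f := fun y ↦ (z.1, y)) z.2
    (mdifferentiableAt_const.prodMk mdifferentiableAt_id)) (mdifferentiableAt_fstCross hY)

lemma sndCrossDeriv_smul {φ : M₁ × M₂ → ℝ} {Y : ∀ z : M₁ × M₂, TangentSpace (I₁.prod I₂) z}
    {z : M₁ × M₂} (hφ : MDifferentiableAt (I₁.prod I₂) 𝓘(ℝ, ℝ) φ z) (hY : MDiffAt (T% Y) z) :
    sndCrossDeriv (φ • Y) z = φ z • sndCrossDeriv Y z +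
      (mvfderiv I₁ (fun x ↦ φ (x, z.2)) z.1).smulRight (sndSection Y z.1 z.2) :=
  mvfderiv_smul (hφ.comp (f := fun x ↦ (x, z.2)) z.1
    (mdifferentiableAt_id.prodMk mdifferentiableAt_const)) (mdifferentiableAt_sndCross hY)

omit [IsManifold I₁ ∞ M₁] [IsManifold I₂ ∞ M₂] in
/-- The inverse of the product trivialization acts componentwise. -/
lemma symmL_trivializationAt_prod [IsManifold I₁ 1 M₁] [IsManifold I₂ 1 M₂] {z₀ z : M₁ × M₂}
    (h₁ : z.1 ∈ (chartAt H₁ z₀.1).source) (h₂ : z.2 ∈ (chartAt H₂ z₀.2).source) (u : E₁ × E₂) :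
    (trivializationAt (E₁ × E₂) (TangentSpace (I₁.prod I₂)) z₀).symmL ℝ z u =
      ((trivializationAt E₁ (TangentSpace I₁) z₀.1).symmL ℝ z.1 u.1,
        (trivializationAt E₂ (TangentSpace I₂) z₀.2).symmL ℝ z.2 u.2) := by
  have hz : z ∈ (chartAt (ModelProd H₁ H₂) z₀).source := ⟨h₁, h₂⟩
  rw [TangentBundle.symmL_trivializationAt_eq_core h₁,
    TangentBundle.symmL_trivializationAt_eq_core h₂,
    TangentBundle.symmL_trivializationAt_eq_core hz]
  have e₁ := hasFDerivWithinAt_tangentCoordChange (I := I₁) (x := z₀.1) (y := z.1) (z := z.1)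
    ⟨by rwa [extChartAt_source], mem_extChartAt_source _⟩
  have e₂ := hasFDerivWithinAt_tangentCoordChange (I := I₂) (x := z₀.2) (y := z.2) (z := z.2)
    ⟨by rwa [extChartAt_source], mem_extChartAt_source _⟩
  have e := hasFDerivWithinAt_tangentCoordChange (I := I₁.prod I₂) (x := z₀) (y := z) (z := z)
    ⟨by rwa [extChartAt_source], mem_extChartAt_source _⟩
  have hr : Set.range (I₁.prod I₂) = Set.range I₁ ×ˢ Set.range I₂ := by
    rw [modelWithCorners_prod_coe, Set.range_prodMap]
  have e' : HasFDerivWithinAt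
      (extChartAt (I₁.prod I₂) z ∘ (extChartAt (I₁.prod I₂) z₀).symm)
      ((tangentCoordChange I₁ z₀.1 z.1 z.1).prodMap (tangentCoordChange I₂ z₀.2 z.2 z.2))
      (Set.range (I₁.prod I₂)) (extChartAt (I₁.prod I₂) z₀ z) := by
    simp only [extChartAt_prod, hr]
    refine HasFDerivWithinAt.prodMap (p := (extChartAt I₁ z₀.1 z.1, extChartAt I₂ z₀.2 z.2))
      (e₁.mono ?_) (e₂.mono ?_)
    · exact Set.fst_image_prod_subset _ _
    · exact Set.snd_image_prod_subset _ _
  have hu := (I₁.prod I₂).uniqueDiffWithinAt_image (x := chartAt (ModelProd H₁ H₂) z₀ z)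
  exact DFunLike.congr_fun (hu.eq e e') u

end ProductSection

section ProductStructure

variable {E₁ : Type*} [NormedAddCommGroup E₁] [NormedSpace ℝ E₁]
  {H₁ : Type*} [TopologicalSpace H₁] {I₁ : ModelWithCorners ℝ E₁ H₁}
  {M₁ : Type*} [TopologicalSpace M₁] [ChartedSpace H₁ M₁] [IsManifold I₁ ∞ M₁]
  {E₂ : Type*} [NormedAddCommGroup E₂] [NormedSpace ℝ E₂]
  {H₂ : Type*} [TopologicalSpace H₂] {I₂ : ModelWithCorners ℝ E₂ H₂}
  {M₂ : Type*} [TopologicalSpace M₂] [ChartedSpace H₂ M₂] [IsManifold I₂ ∞ M₂]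

/-- The product trivialization acts componentwise. -/
lemma continuousLinearMapAt_trivializationAt_prod {z₀ z : M₁ × M₂}
    (h₁ : z.1 ∈ (chartAt H₁ z₀.1).source) (h₂ : z.2 ∈ (chartAt H₂ z₀.2).source)
    (v : TangentSpace (I₁.prod I₂) z) :
    (trivializationAt (E₁ × E₂) (TangentSpace (I₁.prod I₂)) z₀).continuousLinearMapAt ℝ z v =
      ((trivializationAt E₁ (TangentSpace I₁) z₀.1).continuousLinearMapAt ℝ z.1 v.1,
        (trivializationAt E₂ (TangentSpace I₂) z₀.2).continuousLinearMapAt ℝ z.2 v.2) := by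
  have hz : z ∈ (trivializationAt (E₁ × E₂) (TangentSpace (I₁.prod I₂)) z₀).baseSet := ⟨h₁, h₂⟩
  have key := symmL_trivializationAt_prod (I₁ := I₁) (I₂ := I₂) h₁ h₂
    ((trivializationAt E₁ (TangentSpace I₁) z₀.1).continuousLinearMapAt ℝ z.1 v.1,
      (trivializationAt E₂ (TangentSpace I₂) z₀.2).continuousLinearMapAt ℝ z.2 v.2)
  have k₁ := (trivializationAt E₁ (TangentSpace I₁) z₀.1).symmL_continuousLinearMapAt
    (R := ℝ) h₁ v.1
  have k₂ := (trivializationAt E₂ (TangentSpace I₂) z₀.2).symmL_continuousLinearMapAt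
    (R := ℝ) h₂ v.2
  have k := (trivializationAt (E₁ × E₂) (TangentSpace (I₁.prod I₂)) z₀).continuousLinearMapAt_symmL
    (R := ℝ) hz ((trivializationAt E₁ (TangentSpace I₁) z₀.1).continuousLinearMapAt ℝ z.1 v.1,
      (trivializationAt E₂ (TangentSpace I₂) z₀.2).continuousLinearMapAt ℝ z.2 v.2)
  have hv : ((trivializationAt E₁ (TangentSpace I₁) z₀.1).symmL ℝ z.1
        ((trivializationAt E₁ (TangentSpace I₁) z₀.1).continuousLinearMapAt ℝ z.1 v.1),
      (trivializationAt E₂ (TangentSpace I₂) z₀.2).symmL ℝ z.2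
        ((trivializationAt E₂ (TangentSpace I₂) z₀.2).continuousLinearMapAt ℝ z.2 v.2)) = v :=
    Prod.ext k₁ k₂
  exact (congrArg _ (key.trans hv)).symm.trans k

lemma contMDiff_productEnd
    {J₁ : ∀ x : M₁, TangentSpace I₁ x →L[ℝ] TangentSpace I₁ x}
    {J₂ : ∀ y : M₂, TangentSpace I₂ y →L[ℝ] TangentSpace I₂ y}
    (h₁ : ContMDiff I₁ (I₁.prod 𝓘(ℝ, E₁ →L[ℝ] E₁)) ∞
      (fun x ↦ TotalSpace.mk' (E₁ →L[ℝ] E₁)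
        (E := fun x : M₁ ↦ TangentSpace I₁ x →L[ℝ] TangentSpace I₁ x) x (J₁ x)))
    (h₂ : ContMDiff I₂ (I₂.prod 𝓘(ℝ, E₂ →L[ℝ] E₂)) ∞
      (fun x ↦ TotalSpace.mk' (E₂ →L[ℝ] E₂)
        (E := fun x : M₂ ↦ TangentSpace I₂ x →L[ℝ] TangentSpace I₂ x) x (J₂ x))) :
    ContMDiff (I₁.prod I₂) ((I₁.prod I₂).prod 𝓘(ℝ, E₁ × E₂ →L[ℝ] E₁ × E₂)) ∞
      (fun z ↦ TotalSpace.mk' (E₁ × E₂ →L[ℝ] E₁ × E₂)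
        (E := fun z : M₁ × M₂ ↦ TangentSpace (I₁.prod I₂) z →L[ℝ] TangentSpace (I₁.prod I₂) z)
        z (productEnd J₁ J₂ z)) := by
  intro z₀
  have a₁ := h₁ z₀.1
  have a₂ := h₂ z₀.2
  rw [contMDiffAt_hom_bundle] at a₁ a₂ ⊢
  have b₁ := a₁.2.comp z₀ (contMDiffAt_fst (J := I₂) (N := M₂))
  have b₂ := a₂.2.comp z₀ (contMDiffAt_snd (I := I₁) (M := M₁))
  refine ⟨contMDiffAt_id, (b₁.clm_prodMap b₂).congr_of_eventuallyEq ?_⟩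
  filter_upwards [continuous_fst.continuousAt.eventually_mem (chart_source_mem_nhds H₁ z₀.1),
    continuous_snd.continuousAt.eventually_mem (chart_source_mem_nhds H₂ z₀.2)] with z hz₁ hz₂
  refine ContinuousLinearMap.ext fun u ↦ ?_
  have key := symmL_trivializationAt_prod (I₁ := I₁) (I₂ := I₂) hz₁ hz₂ u
  have key' := continuousLinearMapAt_trivializationAt_prod (I₁ := I₁) (I₂ := I₂) hz₁ hz₂
    (productEnd J₁ J₂ z ((trivializationAt (E₁ × E₂)
      (TangentSpace (I₁.prod I₂)) z₀).symmL ℝ z u))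
  refine key'.trans ?_
  rw [key]
  rfl

lemma IsMetallicRiemannian.warped {p q : ℕ} {g₁ : RiemMetric I₁ M₁} {g₂ : RiemMetric I₂ M₂}
    {J₁ : ∀ x : M₁, TangentSpace I₁ x →L[ℝ] TangentSpace I₁ x}
    {J₂ : ∀ y : M₂, TangentSpace I₂ y →L[ℝ] TangentSpace I₂ y}
    (h₁ : IsMetallicRiemannian p q g₁ J₁) (h₂ : IsMetallicRiemannian p q g₂ J₂)
    {f : M₁ → ℝ} (hf : ContMDiff I₁ 𝓘(ℝ, ℝ) ∞ f) (hpos : ∀ x, 0 < f x) :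
    IsMetallicRiemannian p q (warpedMetric g₁ g₂ f hf hpos) (productEnd J₁ J₂) where
  smooth := contMDiff_productEnd h₁.smooth h₂.smooth
  metallic z X := Prod.ext (h₁.metallic z.1 X.1) (h₂.metallic z.2 X.2)
  compatible z X Y := by
    change warpedForm g₁ g₂ f z _ _ = warpedForm g₁ g₂ f z _ _
    rw [warpedForm_apply, warpedForm_apply, mfderiv_fst, mfderiv_snd]
    exact congrArg₂ _ (h₁.compatible z.1 X.1 Y.1)
      (congrArg _ (h₂.compatible z.2 X.2 Y.2))

end ProductStructure

section WarpedConnection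

variable {E₁ : Type*} [NormedAddCommGroup E₁] [NormedSpace ℝ E₁] [FiniteDimensional ℝ E₁]
  {H₁ : Type*} [TopologicalSpace H₁] {I₁ : ModelWithCorners ℝ E₁ H₁}
  {M₁ : Type*} [TopologicalSpace M₁] [ChartedSpace H₁ M₁] [IsManifold I₁ ∞ M₁]
  {E₂ : Type*} [NormedAddCommGroup E₂] [NormedSpace ℝ E₂]
  {H₂ : Type*} [TopologicalSpace H₂] {I₂ : ModelWithCorners ℝ E₂ H₂}
  {M₂ : Type*} [TopologicalSpace M₂] [ChartedSpace H₂ M₂] [IsManifold I₂ ∞ M₂]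

omit [FiniteDimensional ℝ E₁] in
lemma warpedMetric_inner (g₁ : RiemMetric I₁ M₁) (g₂ : RiemMetric I₂ M₂) (f : M₁ → ℝ)
    (hf : ContMDiff I₁ 𝓘(ℝ, ℝ) ∞ f) (hpos : ∀ x, 0 < f x) (z : M₁ × M₂)
    (u v : TangentSpace (I₁.prod I₂) z) :
    (warpedMetric g₁ g₂ f hf hpos).inner z u v =
      g₁.inner z.1 u.1 v.1 + f z.1 ^ 2 * g₂.inner z.2 u.2 v.2 := by
  change warpedForm g₁ g₂ f z _ _ = _
  rw [warpedForm_apply, mfderiv_fst, mfderiv_snd]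
  rfl

variable (cov₁ : CovariantDerivative I₁ E₁ (fun x : M₁ ↦ TangentSpace I₁ x))
  (cov₂ : CovariantDerivative I₂ E₂ (fun y : M₂ ↦ TangentSpace I₂ y))
  (g₁ : RiemMetric I₁ M₁) (g₂ : RiemMetric I₂ M₂) (f : M₁ → ℝ)

/-- The first component of the connection of the warped product:
`∇¹_{X₁} Y₁ + ∂_{X₂} Y₁ - ½ g₂(Y₂, X₂) grad (f²)`. -/
def warpedCovFst (Y : ∀ z : M₁ × M₂, TangentSpace (I₁.prod I₂) z) (z : M₁ × M₂) :
    TangentSpace I₁ z.1 × TangentSpace I₂ z.2 →L[ℝ] TangentSpace I₁ z.1 :=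
  (cov₁ (fstSection Y z.2) z.1).coprod (fstCrossDeriv Y z -
    ((2 : ℝ)⁻¹ • g₂.inner z.2 (sndSection Y z.1 z.2)).smulRight
      (metricGrad g₁ (fun x ↦ f x ^ 2) z.1))

/-- The second component of the connection of the warped product:
`∂_{X₁} Y₂ + ∇²_{X₂} Y₂ + (2 f²)⁻¹ (d(f²)(X₁) Y₂ + d(f²)(Y₁) X₂)`. -/
def warpedCovSnd (Y : ∀ z : M₁ × M₂, TangentSpace (I₁.prod I₂) z) (z : M₁ × M₂) :
    TangentSpace I₁ z.1 × TangentSpace I₂ z.2 →L[ℝ] TangentSpace I₂ z.2 :=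
  (sndCrossDeriv Y z + ((2 * f z.1 ^ 2)⁻¹ • mvfderiv I₁ (fun x ↦ f x ^ 2) z.1).smulRight
      (sndSection Y z.1 z.2)).coprod
    (cov₂ (sndSection Y z.1) z.2 +
      ((2 * f z.1 ^ 2)⁻¹ * mvfderiv I₁ (fun x ↦ f x ^ 2) z.1 (fstSection Y z.2 z.1)) •
        ContinuousLinearMap.id ℝ (TangentSpace I₂ z.2))

/-- The connection of the warped product as a function on vector fields. -/
def warpedCovFun (Y : ∀ z : M₁ × M₂, TangentSpace (I₁.prod I₂) z) (z : M₁ × M₂) :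
    TangentSpace (I₁.prod I₂) z →L[ℝ] TangentSpace (I₁.prod I₂) z :=
  (warpedCovFst cov₁ g₁ g₂ f Y z).prod (warpedCovSnd cov₂ f Y z)

lemma warpedCovFst_apply (Y : ∀ z : M₁ × M₂, TangentSpace (I₁.prod I₂) z) (z : M₁ × M₂)
    (X : TangentSpace I₁ z.1 × TangentSpace I₂ z.2) :
    warpedCovFst cov₁ g₁ g₂ f Y z X =
      cov₁ (fstSection Y z.2) z.1 X.1 + (fstCrossDeriv Y z X.2 -
        ((2 : ℝ)⁻¹ * g₂.inner z.2 (sndSection Y z.1 z.2) X.2) •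
          metricGrad g₁ (fun x ↦ f x ^ 2) z.1) := rfl

omit [FiniteDimensional ℝ E₁] [IsManifold I₁ ∞ M₁] in
lemma warpedCovSnd_apply (Y : ∀ z : M₁ × M₂, TangentSpace (I₁.prod I₂) z) (z : M₁ × M₂)
    (X : TangentSpace I₁ z.1 × TangentSpace I₂ z.2) :
    warpedCovSnd cov₂ f Y z X =
      (sndCrossDeriv Y z X.1 + ((2 * f z.1 ^ 2)⁻¹ * mvfderiv I₁ (fun x ↦ f x ^ 2) z.1 X.1) •
        sndSection Y z.1 z.2) + (cov₂ (sndSection Y z.1) z.2 X.2 +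
        ((2 * f z.1 ^ 2)⁻¹ * mvfderiv I₁ (fun x ↦ f x ^ 2) z.1 (fstSection Y z.2 z.1)) • X.2) := rfl

lemma isCovariantDerivativeOn_warpedCovFun :
    IsCovariantDerivativeOn (E₁ × E₂) (warpedCovFun cov₁ cov₂ g₁ g₂ f) := by
  constructor
  · intro Y Y' z hY hY' _
    have c₁ : ∀ X, warpedCovFst cov₁ g₁ g₂ f (Y + Y') z X =
        warpedCovFst cov₁ g₁ g₂ f Y z X + warpedCovFst cov₁ g₁ g₂ f Y' z X := fun X ↦ by
      have e : fstSection (Y + Y') z.2 = fstSection Y z.2 + fstSection Y' z.2 := rfl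
      have e' : sndSection (Y + Y') z.1 z.2 = sndSection Y z.1 z.2 + sndSection Y' z.1 z.2 := rfl
      simp only [warpedCovFst_apply, fstCrossDeriv_add hY hY', e, e',
        cov₁.isCovariantDerivativeOnUniv.add (mdifferentiableAt_fstSection hY)
          (mdifferentiableAt_fstSection hY'), map_add, add_apply]
      module
    have c₂ : ∀ X, warpedCovSnd cov₂ f (Y + Y') z X =
        warpedCovSnd cov₂ f Y z X + warpedCovSnd cov₂ f Y' z X := fun X ↦ by
      have e : sndSection (Y + Y') z.1 = sndSection Y z.1 + sndSection Y' z.1 := rfl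
      have e' : fstSection (Y + Y') z.2 z.1 = fstSection Y z.2 z.1 + fstSection Y' z.2 z.1 := rfl
      simp only [warpedCovSnd_apply, sndCrossDeriv_add hY hY', e, e',
        cov₂.isCovariantDerivativeOnUniv.add (mdifferentiableAt_sndSection hY)
          (mdifferentiableAt_sndSection hY'), map_add, add_apply, Pi.add_apply]
      module
    exact ContinuousLinearMap.ext fun X ↦ Prod.ext (c₁ X) (c₂ X)
  · intro Y φ z hY hφ _
    have hφ₁ : MDiffAt (fun x ↦ φ (x, z.2)) z.1 :=
      hφ.comp (f := fun x ↦ (x, z.2)) z.1 (mdifferentiableAt_id.prodMk mdifferentiableAt_const)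
    have hφ₂ : MDiffAt (fun y ↦ φ (z.1, y)) z.2 :=
      hφ.comp (f := fun y ↦ (z.1, y)) z.2 (mdifferentiableAt_const.prodMk mdifferentiableAt_id)
    have c₁ : ∀ X, warpedCovFst cov₁ g₁ g₂ f (φ • Y) z X =
        φ z • warpedCovFst cov₁ g₁ g₂ f Y z X +
          (mvfderiv I₁ (fun x ↦ φ (x, z.2)) z.1 X.1 +
            mvfderiv I₂ (fun y ↦ φ (z.1, y)) z.2 X.2) • fstSection Y z.2 z.1 := fun X ↦ by
      have e : fstSection (φ • Y) z.2 = (fun x ↦ φ (x, z.2)) • fstSection Y z.2 := rfl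
      have e' : sndSection (φ • Y) z.1 z.2 = φ z • sndSection Y z.1 z.2 := rfl
      simp only [warpedCovFst_apply, fstCrossDeriv_smul hφ hY, e, e',
        cov₁.isCovariantDerivativeOnUniv.leibniz (mdifferentiableAt_fstSection hY) hφ₁,
        map_smul, add_apply, smul_apply, ContinuousLinearMap.smulRight_apply, smul_eq_mul]
      module
    have c₂ : ∀ X, warpedCovSnd cov₂ f (φ • Y) z X =
        φ z • warpedCovSnd cov₂ f Y z X +
          (mvfderiv I₁ (fun x ↦ φ (x, z.2)) z.1 X.1 +
            mvfderiv I₂ (fun y ↦ φ (z.1, y)) z.2 X.2) • sndSection Y z.1 z.2 := fun X ↦ by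
      have e : sndSection (φ • Y) z.1 = (fun y ↦ φ (z.1, y)) • sndSection Y z.1 := rfl
      have e' : fstSection (φ • Y) z.2 z.1 = φ z • fstSection Y z.2 z.1 := rfl
      simp only [warpedCovSnd_apply, sndCrossDeriv_smul hφ hY, e, e',
        cov₂.isCovariantDerivativeOnUniv.leibniz (mdifferentiableAt_sndSection hY) hφ₂,
        map_smul, add_apply, smul_apply, ContinuousLinearMap.smulRight_apply, smul_eq_mul,
        Pi.smul_apply']
      module
    refine ContinuousLinearMap.ext fun X ↦ Prod.ext ((c₁ X).trans ?_) ((c₂ X).trans ?_)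
    · exact congrArg (fun t : ℝ ↦ φ z • warpedCovFst cov₁ g₁ g₂ f Y z X +
        t • fstSection Y z.2 z.1) (mvfderiv_prod_apply hφ X).symm
    · exact congrArg (fun t : ℝ ↦ φ z • warpedCovSnd cov₂ f Y z X +
        t • sndSection Y z.1 z.2) (mvfderiv_prod_apply hφ X).symm

/-- The connection of the warped product. -/
def warpedCov : CovariantDerivative (I₁.prod I₂) (E₁ × E₂)
    (fun z : M₁ × M₂ ↦ TangentSpace (I₁.prod I₂) z) :=
  ⟨warpedCovFun cov₁ cov₂ g₁ g₂ f, isCovariantDerivativeOn_warpedCovFun cov₁ cov₂ g₁ g₂ f⟩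

end WarpedConnection

section WarpedLeviCivita

lemma mvfderiv_bilin {F : Type*} [NormedAddCommGroup F] [NormedSpace ℝ F]
    {E : Type*} [NormedAddCommGroup E] [NormedSpace ℝ E]
    {H : Type*} [TopologicalSpace H] {I : ModelWithCorners ℝ E H}
    {M : Type*} [TopologicalSpace M] [ChartedSpace H M]
    (B : F →L[ℝ] F →L[ℝ] ℝ) {σ τ : M → F} {x : M}
    (hσ : MDifferentiableAt I 𝓘(ℝ, F) σ x) (hτ : MDifferentiableAt I 𝓘(ℝ, F) τ x) :
    MDifferentiableAt I 𝓘(ℝ, ℝ) (fun y ↦ B (σ y) (τ y)) x ∧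
      ∀ X : TangentSpace I x, mvfderiv I (fun y ↦ B (σ y) (τ y)) x X =
        B (mvfderiv I σ x X) (τ x) + B (σ x) (mvfderiv I τ x X) := by
  have hB := (B.isBoundedBilinearMap.hasFDerivAt (σ x, τ x)).hasMFDerivAt
  have hp : HasMFDerivAt I 𝓘(ℝ, F × F) (fun y ↦ (σ y, τ y)) x
      ((mvfderiv I σ x).prod (mvfderiv I τ x)) :=
    ⟨hσ.hasMFDerivAt.1.prodMk hτ.hasMFDerivAt.1, hσ.hasMFDerivAt.2.prodMk hτ.hasMFDerivAt.2⟩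
  have h := HasMFDerivAt.comp (g := fun p : F × F ↦ B p.1 p.2) x hB hp
  refine ⟨h.mdifferentiableAt, fun X ↦ ?_⟩
  have := DFunLike.congr_fun (h.mfderiv) X
  refine this.trans ?_
  exact add_comm _ _

variable {E₁ : Type*} [NormedAddCommGroup E₁] [NormedSpace ℝ E₁] [FiniteDimensional ℝ E₁]
  {H₁ : Type*} [TopologicalSpace H₁] {I₁ : ModelWithCorners ℝ E₁ H₁}
  {M₁ : Type*} [TopologicalSpace M₁] [ChartedSpace H₁ M₁] [IsManifold I₁ ∞ M₁]
  {E₂ : Type*} [NormedAddCommGroup E₂] [NormedSpace ℝ E₂] [FiniteDimensional ℝ E₂]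
  {H₂ : Type*} [TopologicalSpace H₂] {I₂ : ModelWithCorners ℝ E₂ H₂}
  {M₂ : Type*} [TopologicalSpace M₂] [ChartedSpace H₂ M₂] [IsManifold I₂ ∞ M₂]

omit [FiniteDimensional ℝ E₁] [FiniteDimensional ℝ E₂] in
lemma extend_prod_eventually_eq {z : M₁ × M₂} (v : TangentSpace (I₁.prod I₂) z) :
    ∀ᶠ w in 𝓝 z, FiberBundle.extend (E₁ × E₂) v w =
      ((trivializationAt E₁ (TangentSpace I₁) z.1).symmL ℝ w.1 v.1,
        (trivializationAt E₂ (TangentSpace I₂) z.2).symmL ℝ w.2 v.2) := by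
  filter_upwards [extend_eventually_eq v,
    continuous_fst.continuousAt.eventually_mem (chart_source_mem_nhds H₁ z.1),
    continuous_snd.continuousAt.eventually_mem (chart_source_mem_nhds H₂ z.2)] with w hw h₁ h₂
  exact hw.trans (symmL_trivializationAt_prod h₁ h₂ v)

omit [FiniteDimensional ℝ E₁] [FiniteDimensional ℝ E₂] in
lemma fstSection_extend {z : M₁ × M₂} (v : TangentSpace (I₁.prod I₂) z) :
    ∀ᶠ x in 𝓝 z.1, fstSection (FiberBundle.extend (E₁ × E₂) v) z.2 x =
      FiberBundle.extend E₁ (E := fun x ↦ TangentSpace I₁ x) (x := z.1) v.1 x := by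
  have hc : Filter.Tendsto (fun x ↦ (x, z.2)) (𝓝 z.1) (𝓝 z) :=
    (Continuous.prodMk_left z.2).tendsto z.1
  filter_upwards [hc.eventually (extend_prod_eventually_eq v),
    extend_eventually_eq (I := I₁) (x := z.1) v.1] with x h h'
  exact (congrArg Prod.fst h).trans h'.symm

omit [FiniteDimensional ℝ E₁] [FiniteDimensional ℝ E₂] in
lemma sndSection_extend {z : M₁ × M₂} (v : TangentSpace (I₁.prod I₂) z) :
    ∀ᶠ y in 𝓝 z.2, sndSection (FiberBundle.extend (E₁ × E₂) v) z.1 y =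
      FiberBundle.extend E₂ (E := fun x ↦ TangentSpace I₂ x) (x := z.2) v.2 y := by
  have hc : Filter.Tendsto (fun y ↦ (z.1, y)) (𝓝 z.2) (𝓝 z) :=
    (Continuous.prodMk_right z.1).tendsto z.2
  filter_upwards [hc.eventually (extend_prod_eventually_eq v),
    extend_eventually_eq (I := I₂) (x := z.2) v.2] with x h h'
  exact (congrArg Prod.snd h).trans h'.symm

omit [FiniteDimensional ℝ E₁] [FiniteDimensional ℝ E₂] in
lemma fstCrossDeriv_extend {z : M₁ × M₂} (v : TangentSpace (I₁.prod I₂) z) :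
    fstCrossDeriv (FiberBundle.extend (E₁ × E₂) v) z = 0 := by
  have hc : Filter.Tendsto (fun y ↦ (z.1, y)) (𝓝 z.2) (𝓝 z) :=
    (Continuous.prodMk_right z.1).tendsto z.2
  have h : (fun y ↦ fstSection (FiberBundle.extend (E₁ × E₂) v) y z.1 : M₂ → E₁) =ᶠ[𝓝 z.2]
      fun _ ↦ (trivializationAt E₁ (TangentSpace I₁) z.1).symmL ℝ z.1 v.1 := by
    filter_upwards [hc.eventually (extend_prod_eventually_eq v)] with y hy
    exact congrArg Prod.fst hy
  exact (Filter.EventuallyEq.mfderiv_eq (M' := E₁) (I := I₂) (I' := 𝓘(ℝ, E₁)) h).trans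
    (mfderiv_const (M' := E₁))

omit [FiniteDimensional ℝ E₁] [FiniteDimensional ℝ E₂] in
lemma sndCrossDeriv_extend {z : M₁ × M₂} (v : TangentSpace (I₁.prod I₂) z) :
    sndCrossDeriv (FiberBundle.extend (E₁ × E₂) v) z = 0 := by
  have hc : Filter.Tendsto (fun x ↦ (x, z.2)) (𝓝 z.1) (𝓝 z) :=
    (Continuous.prodMk_left z.2).tendsto z.1
  have h : (fun x ↦ sndSection (FiberBundle.extend (E₁ × E₂) v) x z.2 : M₁ → E₂) =ᶠ[𝓝 z.1]
      fun _ ↦ (trivializationAt E₂ (TangentSpace I₂) z.2).symmL ℝ z.2 v.2 := by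
    filter_upwards [hc.eventually (extend_prod_eventually_eq v)] with y hy
    exact congrArg Prod.snd hy
  exact (Filter.EventuallyEq.mfderiv_eq (M' := E₂) (I := I₁) (I' := 𝓘(ℝ, E₂)) h).trans
    (mfderiv_const (M' := E₂))

variable {cov₁ : CovariantDerivative I₁ E₁ (fun x : M₁ ↦ TangentSpace I₁ x)}
  {cov₂ : CovariantDerivative I₂ E₂ (fun y : M₂ ↦ TangentSpace I₂ y)}
  {g₁ : RiemMetric I₁ M₁} {g₂ : RiemMetric I₂ M₂} {f : M₁ → ℝ}

lemma torsion_warpedCov (h₁ : cov₁.torsion = 0) (h₂ : cov₂.torsion = 0) :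
    (warpedCov cov₁ cov₂ g₁ g₂ f).torsion = 0 := by
  rw [torsion_eq_zero_iff_extend] at h₁ h₂ ⊢
  intro z u v
  let extn (w : TangentSpace I₁ z.1 × TangentSpace I₂ z.2) :
      ∀ z : M₁ × M₂, TangentSpace (I₁.prod I₂) z :=
    FiberBundle.extend (E₁ × E₂) (E := fun z ↦ TangentSpace (I₁.prod I₂) z) (x := z) w
  have hm : ∀ w : TangentSpace I₁ z.1 × TangentSpace I₂ z.2,
      MDiffAt (T% (extn w)) z :=
    fun w ↦ FiberBundle.mdifferentiableAt_extend _ _ _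
  have e₁ : ∀ w : TangentSpace I₁ z.1 × TangentSpace I₂ z.2,
      cov₁ (fstSection (extn w) z.2) z.1 =
        cov₁ (FiberBundle.extend E₁ (E := fun x ↦ TangentSpace I₁ x) w.1) z.1 :=
    fun w ↦ (cov₁.isCovariantDerivativeOn (s := Set.univ)).congr_of_eventuallyEq
      (mdifferentiableAt_fstSection (hm w)) (FiberBundle.mdifferentiableAt_extend _ _ _)
      Filter.univ_mem (fstSection_extend (I₁ := I₁) (I₂ := I₂) (z := z) w)
  have e₂ : ∀ w : TangentSpace I₁ z.1 × TangentSpace I₂ z.2,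
      cov₂ (sndSection (extn w) z.1) z.2 =
        cov₂ (FiberBundle.extend E₂ (E := fun x ↦ TangentSpace I₂ x) w.2) z.2 :=
    fun w ↦ (cov₂.isCovariantDerivativeOn (s := Set.univ)).congr_of_eventuallyEq
      (mdifferentiableAt_sndSection (hm w)) (FiberBundle.mdifferentiableAt_extend _ _ _)
      Filter.univ_mem (sndSection_extend (I₁ := I₁) (I₂ := I₂) (z := z) w)
  have e₃ : ∀ w : TangentSpace I₁ z.1 × TangentSpace I₂ z.2,
      fstSection (extn w) z.2 z.1 = w.1 :=
    fun w ↦ congrArg Prod.fst (FiberBundle.extend_apply_self (F := E₁ × E₂)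
      (E := fun z ↦ TangentSpace (I₁.prod I₂) z) (x := z) w)
  have e₄ : ∀ w : TangentSpace I₁ z.1 × TangentSpace I₂ z.2,
      sndSection (extn w) z.1 z.2 = w.2 :=
    fun w ↦ congrArg Prod.snd (FiberBundle.extend_apply_self (F := E₁ × E₂)
      (E := fun z ↦ TangentSpace (I₁.prod I₂) z) (x := z) w)
  have e₅ : ∀ w : TangentSpace I₁ z.1 × TangentSpace I₂ z.2,
      fstCrossDeriv (extn w) z = 0 := fun w ↦ fstCrossDeriv_extend (I₁ := I₁) (I₂ := I₂) (z := z) w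
  have e₆ : ∀ w : TangentSpace I₁ z.1 × TangentSpace I₂ z.2,
      sndCrossDeriv (extn w) z = 0 := fun w ↦ sndCrossDeriv_extend (I₁ := I₁) (I₂ := I₂) (z := z) w
  have c₁ : ∀ u v : TangentSpace I₁ z.1 × TangentSpace I₂ z.2,
      warpedCovFst cov₁ g₁ g₂ f (extn v) z u =
      warpedCovFst cov₁ g₁ g₂ f (extn u) z v := fun u v ↦ by
    rw [warpedCovFst_apply, warpedCovFst_apply, e₁, e₁, e₄, e₄, e₅, e₅, h₁ z.1 u.1 v.1,
      g₂.symm z.2 u.2 v.2, zero_apply, zero_apply]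
  have c₂ : ∀ u v : TangentSpace I₁ z.1 × TangentSpace I₂ z.2,
      warpedCovSnd cov₂ f (extn v) z u = warpedCovSnd cov₂ f (extn u) z v :=
    fun u v ↦ by
      rw [warpedCovSnd_apply, warpedCovSnd_apply, e₂, e₂, e₃, e₃, e₄, e₄, e₆, e₆,
        h₂ z.2 u.2 v.2, zero_apply, zero_apply]
      module
  exact Prod.ext (c₁ u v) (c₂ u v)

lemma isLeviCivita_warpedCov (h₁ : IsLeviCivita g₁ cov₁) (h₂ : IsLeviCivita g₂ cov₂)
    (hf : ContMDiff I₁ 𝓘(ℝ, ℝ) ∞ f) (hpos : ∀ x, 0 < f x) :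
    IsLeviCivita (warpedMetric g₁ g₂ f hf hpos) (warpedCov cov₁ cov₂ g₁ g₂ f) := by
  rw [isLeviCivita_iff] at h₁ h₂ ⊢
  refine ⟨torsion_warpedCov h₁.1 h₂.1, fun z X Y Z hY hZ ↦ ?_⟩
  have hd := (warpedMetric g₁ g₂ f hf hpos).mdifferentiableAt_inner hY hZ
  have hF : MDifferentiableAt I₁ 𝓘(ℝ, ℝ) (fun x ↦ f x ^ 2) z.1 :=
    (hf.pow 2).mdifferentiable (by simp) z.1
  have A₁ := g₁.mdifferentiableAt_inner (mdifferentiableAt_fstSection hY)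
    (mdifferentiableAt_fstSection hZ)
  have A₂ := g₂.mdifferentiableAt_inner (mdifferentiableAt_sndSection hY)
    (mdifferentiableAt_sndSection hZ)
  have D₁ := fun X₁ ↦ h₁.2 z.1 X₁ _ _ (mdifferentiableAt_fstSection hY) (mdifferentiableAt_fstSection hZ)
  have D₂ := fun X₂ ↦ h₂.2 z.2 X₂ _ _ (mdifferentiableAt_sndSection hY) (mdifferentiableAt_sndSection hZ)
  have BC₁ : MDifferentiableAt I₂ 𝓘(ℝ, ℝ)
      (fun y ↦ g₁.inner z.1 (fstSection Y y z.1) (fstSection Z y z.1)) z.2 ∧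
      ∀ X₂, mvfderiv I₂ (fun y ↦ g₁.inner z.1 (fstSection Y y z.1) (fstSection Z y z.1)) z.2 X₂ =
        g₁.inner z.1 (fstCrossDeriv Y z X₂) (fstSection Z z.2 z.1) +
          g₁.inner z.1 (fstSection Y z.2 z.1) (fstCrossDeriv Z z X₂) :=
    mvfderiv_bilin (F := E₁) (g₁.inner z.1) (mdifferentiableAt_fstCross hY)
      (mdifferentiableAt_fstCross hZ)
  have BC₂ : MDifferentiableAt I₁ 𝓘(ℝ, ℝ)
      (fun x ↦ g₂.inner z.2 (sndSection Y x z.2) (sndSection Z x z.2)) z.1 ∧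
      ∀ X₁, mvfderiv I₁ (fun x ↦ g₂.inner z.2 (sndSection Y x z.2) (sndSection Z x z.2)) z.1 X₁ =
        g₂.inner z.2 (sndCrossDeriv Y z X₁) (sndSection Z z.1 z.2) +
          g₂.inner z.2 (sndSection Y z.1 z.2) (sndCrossDeriv Z z X₁) :=
    mvfderiv_bilin (F := E₂) (g₂.inner z.2) (mdifferentiableAt_sndCross hY)
      (mdifferentiableAt_sndCross hZ)
  obtain ⟨B₁, C₁⟩ := BC₁
  obtain ⟨B₂, C₂⟩ := BC₂
  have hFB : MDifferentiableAt I₁ 𝓘(ℝ, ℝ) (fun x ↦ f x ^ 2 *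
      g₂.inner z.2 (sndSection Y x z.2) (sndSection Z x z.2)) z.1 := hF.mul B₂
  have hFA : MDifferentiableAt I₂ 𝓘(ℝ, ℝ) (fun y ↦ f z.1 ^ 2 *
      g₂.inner y (sndSection Y z.1 y) (sndSection Z z.1 y)) z.2 := mdifferentiableAt_const.mul A₂
  have L₁ : ∀ X₁, mvfderiv I₁ (fun x ↦ g₁.inner x (fstSection Y z.2 x) (fstSection Z z.2 x) +
      f x ^ 2 * g₂.inner z.2 (sndSection Y x z.2) (sndSection Z x z.2)) z.1 X₁ =
      (g₁.inner z.1 (cov₁ (fstSection Y z.2) z.1 X₁) (fstSection Z z.2 z.1) +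
        g₁.inner z.1 (fstSection Y z.2 z.1) (cov₁ (fstSection Z z.2) z.1 X₁)) +
      (f z.1 ^ 2 * (g₂.inner z.2 (sndCrossDeriv Y z X₁) (sndSection Z z.1 z.2) +
        g₂.inner z.2 (sndSection Y z.1 z.2) (sndCrossDeriv Z z X₁)) +
      g₂.inner z.2 (sndSection Y z.1 z.2) (sndSection Z z.1 z.2) *
        mvfderiv I₁ (fun x ↦ f x ^ 2) z.1 X₁) := fun X₁ ↦ by
    rw [mvfderiv_fun_add A₁ hFB, mvfderiv_fun_mul hF B₂, add_apply, D₁, add_apply,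
      smul_apply, smul_apply, C₂]
    rfl
  have L₂ : ∀ X₂, mvfderiv I₂ (fun y ↦ g₁.inner z.1 (fstSection Y y z.1) (fstSection Z y z.1) +
      f z.1 ^ 2 * g₂.inner y (sndSection Y z.1 y) (sndSection Z z.1 y)) z.2 X₂ =
      (g₁.inner z.1 (fstCrossDeriv Y z X₂) (fstSection Z z.2 z.1) +
        g₁.inner z.1 (fstSection Y z.2 z.1) (fstCrossDeriv Z z X₂)) +
      f z.1 ^ 2 * (g₂.inner z.2 (cov₂ (sndSection Y z.1) z.2 X₂) (sndSection Z z.1 z.2) +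
        g₂.inner z.2 (sndSection Y z.1 z.2) (cov₂ (sndSection Z z.1) z.2 X₂)) := fun X₂ ↦ by
    rw [mvfderiv_fun_add B₁ hFA,
      mvfderiv_fun_mul mdifferentiableAt_const A₂, add_apply, C₁, add_apply,
      smul_apply, smul_apply, D₂, mvfderiv_const, zero_apply, smul_zero, add_zero]
    rfl
  have hz : f z.1 ≠ 0 := (hpos z.1).ne'
  have main : ∀ (X₁ : TangentSpace I₁ z.1) (X₂ : TangentSpace I₂ z.2),
      mvfderiv I₁ (fun x ↦ g₁.inner x (fstSection Y z.2 x) (fstSection Z z.2 x) +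
          f x ^ 2 * g₂.inner z.2 (sndSection Y x z.2) (sndSection Z x z.2)) z.1 X₁ +
        mvfderiv I₂ (fun y ↦ g₁.inner z.1 (fstSection Y y z.1) (fstSection Z y z.1) +
          f z.1 ^ 2 * g₂.inner y (sndSection Y z.1 y) (sndSection Z z.1 y)) z.2 X₂ =
      g₁.inner z.1 (warpedCovFst cov₁ g₁ g₂ f Y z (X₁, X₂)) (fstSection Z z.2 z.1) +
        f z.1 ^ 2 * g₂.inner z.2 (warpedCovSnd cov₂ f Y z (X₁, X₂)) (sndSection Z z.1 z.2) +
      (g₁.inner z.1 (fstSection Y z.2 z.1) (warpedCovFst cov₁ g₁ g₂ f Z z (X₁, X₂)) +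
        f z.1 ^ 2 * g₂.inner z.2 (sndSection Y z.1 z.2)
          (warpedCovSnd cov₂ f Z z (X₁, X₂))) := fun X₁ X₂ ↦ by
    rw [L₁, L₂, g₁.symm z.1 (fstSection Y z.2 z.1) (warpedCovFst cov₁ g₁ g₂ f Z z (X₁, X₂)),
      g₁.symm z.1 (fstSection Y z.2 z.1), g₁.symm z.1 (fstSection Y z.2 z.1)]
    simp only [warpedCovFst_apply, warpedCovSnd_apply, map_add, map_sub, map_smul, add_apply,
      sub_apply, smul_apply, smul_eq_mul, inner_metricGrad]
    rw [g₂.symm z.2 X₂ (sndSection Z z.1 z.2)]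
    field_simp
    ring
  rw [mvfderiv_prod_apply hd, warpedMetric_inner, warpedMetric_inner]
  simp only [warpedMetric_inner]
  exact main X.1 X.2

omit [FiniteDimensional ℝ E₂] in
/-- The covariant derivative of the product structure on a warped product: first component. -/
lemma warpedCovFst_productEnd {J₁ : ∀ x : M₁, TangentSpace I₁ x →L[ℝ] TangentSpace I₁ x}
    {J₂ : ∀ y : M₂, TangentSpace I₂ y →L[ℝ] TangentSpace I₂ y} (h₁ : IsParallelEnd cov₁ J₁)
    {Y : ∀ z : M₁ × M₂, TangentSpace (I₁.prod I₂) z} {z : M₁ × M₂} (hY : MDiffAt (T% Y) z)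
    (X : TangentSpace I₁ z.1 × TangentSpace I₂ z.2) :
    J₁ z.1 (warpedCovFst cov₁ g₁ g₂ f Y z X) -
        warpedCovFst cov₁ g₁ g₂ f (fun w ↦ productEnd J₁ J₂ w (Y w)) z X =
      (2 : ℝ)⁻¹ • (g₂.inner z.2 (J₂ z.2 (sndSection Y z.1 z.2)) X.2 •
          metricGrad g₁ (fun x ↦ f x ^ 2) z.1 -
        g₂.inner z.2 (sndSection Y z.1 z.2) X.2 •
          J₁ z.1 (metricGrad g₁ (fun x ↦ f x ^ 2) z.1)) := by
  have e₁ : cov₁ (fstSection (fun w ↦ productEnd J₁ J₂ w (Y w)) z.2) z.1 X.1 =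
      J₁ z.1 (cov₁ (fstSection Y z.2) z.1 X.1) :=
    h₁ _ _ (mdifferentiableAt_fstSection hY) _
  have e₂ : fstCrossDeriv (fun w ↦ productEnd J₁ J₂ w (Y w)) z X.2 =
      J₁ z.1 (fstCrossDeriv Y z X.2) := by
    have := HasMFDerivAt.comp (I' := 𝓘(ℝ, E₁)) (I'' := 𝓘(ℝ, E₁)) (M' := E₁) (M'' := E₁) z.2
      (ContinuousLinearMap.hasMFDerivAt (E := E₁) (E' := E₁) (J₁ z.1))
      (mdifferentiableAt_fstCross hY).hasMFDerivAt
    exact DFunLike.congr_fun (this.mfderiv) X.2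
  have e₃ : sndSection (fun w ↦ productEnd J₁ J₂ w (Y w)) z.1 z.2 =
      J₂ z.2 (sndSection Y z.1 z.2) := rfl
  rw [warpedCovFst_apply, warpedCovFst_apply, e₁, e₂, e₃]
  simp only [map_add, map_sub, map_smul]
  module

omit [FiniteDimensional ℝ E₁] [FiniteDimensional ℝ E₂] in
/-- The covariant derivative of the product structure on a warped product: second component. -/
lemma warpedCovSnd_productEnd {J₁ : ∀ x : M₁, TangentSpace I₁ x →L[ℝ] TangentSpace I₁ x}
    {J₂ : ∀ y : M₂, TangentSpace I₂ y →L[ℝ] TangentSpace I₂ y} (h₂ : IsParallelEnd cov₂ J₂)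
    {Y : ∀ z : M₁ × M₂, TangentSpace (I₁.prod I₂) z} {z : M₁ × M₂} (hY : MDiffAt (T% Y) z)
    (X : TangentSpace I₁ z.1 × TangentSpace I₂ z.2) :
    warpedCovSnd cov₂ f (fun w ↦ productEnd J₁ J₂ w (Y w)) z X -
        J₂ z.2 (warpedCovSnd cov₂ f Y z X) =
      (2 * f z.1 ^ 2)⁻¹ •
        (mvfderiv I₁ (fun x ↦ f x ^ 2) z.1 (J₁ z.1 (fstSection Y z.2 z.1)) • X.2 -
          mvfderiv I₁ (fun x ↦ f x ^ 2) z.1 (fstSection Y z.2 z.1) • J₂ z.2 X.2) := by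
  have e₁ : cov₂ (sndSection (fun w ↦ productEnd J₁ J₂ w (Y w)) z.1) z.2 X.2 =
      J₂ z.2 (cov₂ (sndSection Y z.1) z.2 X.2) :=
    h₂ _ _ (mdifferentiableAt_sndSection hY) _
  have e₂ : sndCrossDeriv (fun w ↦ productEnd J₁ J₂ w (Y w)) z X.1 =
      J₂ z.2 (sndCrossDeriv Y z X.1) := by
    have := HasMFDerivAt.comp (I' := 𝓘(ℝ, E₂)) (I'' := 𝓘(ℝ, E₂)) (M' := E₂) (M'' := E₂) z.1
      (ContinuousLinearMap.hasMFDerivAt (E := E₂) (E' := E₂) (J₂ z.2))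
      (mdifferentiableAt_sndCross hY).hasMFDerivAt
    exact DFunLike.congr_fun (this.mfderiv) X.1
  have e₃ : sndSection (fun w ↦ productEnd J₁ J₂ w (Y w)) z.1 z.2 =
      J₂ z.2 (sndSection Y z.1 z.2) := rfl
  have e₄ : fstSection (fun w ↦ productEnd J₁ J₂ w (Y w)) z.2 z.1 =
      J₁ z.1 (fstSection Y z.2 z.1) := rfl
  rw [warpedCovSnd_apply, warpedCovSnd_apply, e₁, e₂, e₃, e₄]
  simp only [map_add, map_smul]
  module

omit [FiniteDimensional ℝ E₂] in
lemma isParallelEnd_warpedCov_iff {J₁ : ∀ x : M₁, TangentSpace I₁ x →L[ℝ] TangentSpace I₁ x}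
    {J₂ : ∀ y : M₂, TangentSpace I₂ y →L[ℝ] TangentSpace I₂ y} (h₁ : IsParallelEnd cov₁ J₁)
    (h₂ : IsParallelEnd cov₂ J₂) (hpos : ∀ x, 0 < f x) :
    IsParallelEnd (warpedCov cov₁ cov₂ g₁ g₂ f) (productEnd J₁ J₂) ↔
      (∀ (x : M₁) (y : M₂) (X : TangentSpace I₁ x) (V : TangentSpace I₂ y),
        mvfderiv I₁ (fun x' ↦ f x' ^ 2) x (J₁ x X) • V =
          mvfderiv I₁ (fun x' ↦ f x' ^ 2) x X • J₂ y V) ∧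
      (∀ (x : M₁) (y : M₂) (V W : TangentSpace I₂ y),
        g₂.inner y (J₂ y V) W • metricGrad g₁ (fun x' ↦ f x' ^ 2) x =
          g₂.inner y V W • J₁ x (metricGrad g₁ (fun x' ↦ f x' ^ 2) x)) := by
  have hne : ∀ x, (2 * f x ^ 2)⁻¹ ≠ 0 := fun x ↦
    inv_ne_zero (mul_ne_zero two_ne_zero (pow_ne_zero 2 (hpos x).ne'))
  constructor
  · intro h
    have hm : ∀ {z : M₁ × M₂} (w : TangentSpace (I₁.prod I₂) z),
        MDiffAt (T% (FiberBundle.extend (E₁ × E₂) w)) z :=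
      fun w ↦ FiberBundle.mdifferentiableAt_extend _ _ w
    constructor
    · intro x y X V
      let w : TangentSpace (I₁.prod I₂) (x, y) := (X, (0 : TangentSpace I₂ y))
      have e : fstSection (FiberBundle.extend (E₁ × E₂) w) y x = X :=
        congrArg Prod.fst (FiberBundle.extend_apply_self (F := E₁ × E₂) w)
      have k := warpedCovSnd_productEnd (f := f) (J₁ := J₁) h₂ (hm w)
        ((0 : TangentSpace I₁ x), V)
      have p := congrArg Prod.snd (h _ _ (hm w) ((0 : TangentSpace I₁ x), V))
      replace k := k.symm.trans (sub_eq_zero_of_eq p)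
      dsimp only at k
      rw [e] at k
      exact sub_eq_zero.1 ((smul_eq_zero.1 k).resolve_left (hne x))
    · intro x y V W
      let w : TangentSpace (I₁.prod I₂) (x, y) := ((0 : TangentSpace I₁ x), V)
      have e : sndSection (FiberBundle.extend (E₁ × E₂) w) x y = V :=
        congrArg Prod.snd (FiberBundle.extend_apply_self (F := E₁ × E₂) w)
      have k := warpedCovFst_productEnd (f := f) (g₁ := g₁) (g₂ := g₂) (J₂ := J₂) h₁ (hm w)
        ((0 : TangentSpace I₁ x), W)
      have p := congrArg Prod.fst (h _ _ (hm w) ((0 : TangentSpace I₁ x), W))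
      replace k := k.symm.trans (sub_eq_zero_of_eq p.symm)
      dsimp only at k
      rw [e] at k
      exact sub_eq_zero.1 ((smul_eq_zero.1 k).resolve_left (by norm_num))
  · rintro ⟨k₁, k₂⟩ Y z hY X
    refine Prod.ext ?_ ?_
    · have := warpedCovFst_productEnd (f := f) (g₁ := g₁) (g₂ := g₂) (J₂ := J₂) h₁ hY (X.1, X.2)
      rw [k₂ z.1 z.2, sub_self, smul_zero] at this
      exact (sub_eq_zero.1 this).symm
    · have := warpedCovSnd_productEnd (f := f) (J₁ := J₁) h₂ hY (X.1, X.2)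
      rw [k₁ z.1 z.2, sub_self, smul_zero] at this
      exact sub_eq_zero.1 this

/-- A warped product of locally metallic Riemannian manifolds is locally metallic if and only if
`d(f²) ∘ J₁ ⊗ I = d(f²) ⊗ J₂` and `g₂(J₂ ·, ·) grad f² = g₂(·, ·) J₁ (grad f²)`. -/
lemma isLocallyMetallic_warped_iff {p q : ℕ}
    {J₁ : ∀ x : M₁, TangentSpace I₁ x →L[ℝ] TangentSpace I₁ x}
    {J₂ : ∀ y : M₂, TangentSpace I₂ y →L[ℝ] TangentSpace I₂ y}
    (h₁ : IsLocallyMetallic p q g₁ J₁) (h₂ : IsLocallyMetallic p q g₂ J₂)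
    (hf : ContMDiff I₁ 𝓘(ℝ, ℝ) ∞ f) (hpos : ∀ x, 0 < f x) :
    IsLocallyMetallic p q (warpedMetric g₁ g₂ f hf hpos) (productEnd J₁ J₂) ↔
      (∀ (x : M₁) (y : M₂) (X : TangentSpace I₁ x) (V : TangentSpace I₂ y),
        mvfderiv I₁ (fun x' ↦ f x' ^ 2) x (J₁ x X) • V =
          mvfderiv I₁ (fun x' ↦ f x' ^ 2) x X • J₂ y V) ∧
      (∀ (x : M₁) (y : M₂) (V W : TangentSpace I₂ y),
        g₂.inner y (J₂ y V) W • metricGrad g₁ (fun x' ↦ f x' ^ 2) x =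
          g₂.inner y V W • J₁ x (metricGrad g₁ (fun x' ↦ f x' ^ 2) x)) := by
  obtain ⟨m₁, cov₁, l₁, p₁⟩ := h₁
  obtain ⟨m₂, cov₂, l₂, p₂⟩ := h₂
  rw [← isParallelEnd_warpedCov_iff p₁ p₂ hpos]
  have hm := m₁.warped m₂ hf hpos
  have hlc := isLeviCivita_warpedCov l₁ l₂ hf hpos
  refine ⟨fun ⟨_, cov, l, p⟩ Y z hY X ↦ ?_, fun h ↦ ⟨hm, _, hlc, h⟩⟩
  have hJY : MDiffAt (T% fun w ↦ productEnd J₁ J₂ w (Y w)) z :=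
    ((hm.smooth z).mdifferentiableAt (by simp)).clm_bundle_apply hY
  rw [← l.unique hlc hJY, ← l.unique hlc hY]
  exact p Y z hY X

end WarpedLeviCivita

end

theorem mainTheorem1
    {E₁ : Type*} [NormedAddCommGroup E₁] [NormedSpace ℝ E₁] [FiniteDimensional ℝ E₁]
    {M₁ : Type*} [TopologicalSpace M₁] [ChartedSpace E₁ M₁] [IsManifold 𝓘(ℝ, E₁) ∞ M₁]
    {E₂ : Type*} [NormedAddCommGroup E₂] [NormedSpace ℝ E₂] [FiniteDimensional ℝ E₂]
    {M₂ : Type*} [TopologicalSpace M₂] [ChartedSpace E₂ M₂] [IsManifold 𝓘(ℝ, E₂) ∞ M₂]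
    (p q : ℕ) (hp : p ≠ 0) (hq : q ≠ 0)
    (g₁ : RiemMetric 𝓘(ℝ, E₁) M₁) (g₂ : RiemMetric 𝓘(ℝ, E₂) M₂)
    (J₁ : ∀ x : M₁, TangentSpace 𝓘(ℝ, E₁) x →L[ℝ] TangentSpace 𝓘(ℝ, E₁) x)
    (J₂ : ∀ y : M₂, TangentSpace 𝓘(ℝ, E₂) y →L[ℝ] TangentSpace 𝓘(ℝ, E₂) y)
    (h₁ : IsLocallyMetallic p q g₁ J₁) (h₂ : IsLocallyMetallic p q g₂ J₂)
    (f : M₁ → ℝ) (hf : ContMDiff 𝓘(ℝ, E₁) 𝓘(ℝ, ℝ) ∞ f) (hpos : ∀ x, 0 < f x) :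
    IsLocallyMetallic p q (warpedMetric g₁ g₂ f hf hpos) (productEnd J₁ J₂) ↔
      (∀ (x : M₁) (y : M₂) (X : TangentSpace 𝓘(ℝ, E₁) x) (V : TangentSpace 𝓘(ℝ, E₂) y),
        mvfderiv 𝓘(ℝ, E₁) (fun x' ↦ f x' ^ 2) x (J₁ x X) • V =
          mvfderiv 𝓘(ℝ, E₁) (fun x' ↦ f x' ^ 2) x X • J₂ y V) ∧
      (∀ (x : M₁) (y : M₂) (V W : TangentSpace 𝓘(ℝ, E₂) y),
        g₂.inner y (J₂ y V) W • metricGrad g₁ (fun x' ↦ f x' ^ 2) x =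
          g₂.inner y V W • J₁ x (metricGrad g₁ (fun x' ↦ f x' ^ 2) x)) :=
  isLocallyMetallic_warped_iff h₁ h₂ hf hpos
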